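/- Let $K$ be a field and let $\mathcal{C}$ be a small $K$-category, i.e. a small category whose morphism sets $\mathcal{C}(X,Y)$ are $K$-vector spaces and whose composition is $K$-bilinear. Let $\mathrm{Mod}(\mathcal{C})=\mathrm{Fun}_K(\mathcal{C},\mathrm{Mod}(K))$ be the abelian category of covariant $K$-linear functors from $\mathcal{C}$ to $K$-vector spaces. A two-sided ideal $\mathcal{I}$ of $\mathcal{C}$ consists of $K$-subspaces $\mathcal{I}(X,Y)\subseteq\mathcal{C}(X,Y)$, for all objects $X,Y$, that are stable under composition on either side with arbitrary morphisms of $\mathcal{C}$; it is idempotent if $\mathcal{I}^2=\mathcal{I}$, where $\mathcal{I}^2(X,Z)$ is the set of finite sums of composites $gf$ with $f\in\mathcal{I}(X,Y)$, $g\in\mathcal{I}(Y,Z)$ and $Y$ an object of $\mathcal{C}$. Let $\mathcal{C}/\mathcal{I}$ be the quotient $K$-category, with the objects of $\mathcal{C}$ and with $(\mathcal{C}/\mathcal{I})(X,Y)=\mathcal{C}(X,Y)/\mathcal{I}(X,Y)$, let $\pi:\mathcal{C}\to\mathcal{C}/\mathcal{I}$ be the canonical projection, and let $\pi_*:\mathrm{Mod}(\mathcal{C}/\mathcal{I})\to\mathrm{Mod}(\mathcal{C})$,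 $F\mapsto F\circ\pi$, be the (exact) restriction functor. The ideal $\mathcal{I}$ is called strongly idempotent if the canonical map induced by $\pi_*$, $$\mathrm{Ext}^{i}_{\mathrm{Mod}(\mathcal{C}/\mathcal{I})}(F,F')\longrightarrow \mathrm{Ext}^{i}_{\mathrm{Mod}(\mathcal{C})}(\pi_*F,\pi_*F'),$$ is an isomorphism for all $F,F'\in\mathrm{Mod}(\mathcal{C}/\mathcal{I})$ and all $i\geq 0$. Proposition. Let $\mathcal{I}$ be an idempotent two-sided ideal of $\mathcal{C}$ such that $\mathcal{I}(C,-)$ is projective in $\mathrm{Mod}(\mathcal{C})$ for every object $C$ of $\mathcal{C}$. Then $\mathcal{I}$ is strongly idempotent. -/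

import Mathlib

open CategoryTheory CategoryTheory.Limits

universe u

noncomputable section

/-! ## Modules over a small `K`-category -/

namespace KCat

section Modules

variable (K : Type u) [Field K] (C : Type u) [SmallCategory C] [Preadditive C] [Linear K C]

/-- The property of being a `K`-functor `C ⥤ Mod(K)`: the maps on morphism spaces are
additive and commute with scalars, that is, they are `K`-linear. -/
def isKFunctor : ObjectProperty (C ⥤ ModuleCat.{u} K) :=
  fun F => F.Additive ∧ F.Linear K

variable {K C} in
lemma isKFunctor.of_mono {F G : C ⥤ ModuleCat.{u} K} (i : F ⟶ G) [Mono i]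
    (hG : isKFunctor K C G) : isKFunctor K C F := by
  obtain ⟨_, _⟩ := hG
  refine ⟨⟨fun {X Y f g} => ?_⟩, ⟨fun {X Y} f r => ?_⟩⟩
  · rw [← cancel_mono (i.app Y)]
    simp [Preadditive.add_comp]
  · rw [← cancel_mono (i.app Y)]
    simp

variable {K C} in
lemma isKFunctor.of_epi {F G : C ⥤ ModuleCat.{u} K} (p : F ⟶ G) [Epi p]
    (hF : isKFunctor K C F) : isKFunctor K C G := by
  obtain ⟨_, _⟩ := hF
  refine ⟨⟨fun {X Y f g} => ?_⟩, ⟨fun {X Y} f r => ?_⟩⟩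
  · rw [← cancel_epi (p.app X)]
    simp only [Preadditive.comp_add, ← p.naturality, Functor.map_add, Preadditive.add_comp]
  · rw [← cancel_epi (p.app X)]
    simp only [Linear.comp_smul, ← p.naturality, Functor.map_smul, Linear.smul_comp]

instance : (isKFunctor K C).IsClosedUnderSubobjects where
  prop_of_mono i _ h := isKFunctor.of_mono i h

instance : (isKFunctor K C).IsClosedUnderQuotients where
  prop_of_epi p _ h := isKFunctor.of_epi p h

instance : (isKFunctor K C).ContainsZero where
  exists_zero := by
    open ZeroObject in
    refine ⟨0, isZero_zero _, ⟨fun {X Y f g} => ?_⟩, ⟨fun {X Y} f r => ?_⟩⟩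
    all_goals exact ((isZero_zero (C ⥤ ModuleCat.{u} K)).obj X).eq_of_src _ _

instance : (isKFunctor K C).IsClosedUnderFiniteProducts where
  isClosedUnderLimitsOfShape J _ := ⟨by
    rintro F ⟨p⟩
    have key : ∀ (Y : C) {W : ModuleCat.{u} K} (a b : W ⟶ F.obj Y),
        (∀ j, a ≫ (p.π.app j).app Y = b ≫ (p.π.app j).app Y) → a = b := fun Y _ a b h =>
      (isLimitOfPreserves ((evaluation C (ModuleCat.{u} K)).obj Y) p.isLimit).hom_ext h
    refine ⟨⟨fun {X Y f g} => key _ _ _ fun j => ?_⟩, ⟨fun {X Y} f r => key _ _ _ fun j => ?_⟩⟩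
    · obtain ⟨_, _⟩ := p.prop_diag_obj j
      simp [Preadditive.add_comp]
    · obtain ⟨_, _⟩ := p.prop_diag_obj j
      simp⟩

/-- The category `Mod(C) = Fun_K(C, Mod(K))` of left `C`-modules: covariant `K`-functors from
`C` to `K`-vector spaces, with all natural transformations as morphisms. -/
abbrev Mod := (isKFunctor K C).FullSubcategory

instance : PreservesFiniteLimits (isKFunctor K C).ι :=
  have := (isKFunctor K C).preservesKernels_ι
  Functor.preservesFiniteLimits_of_preservesKernels _

instance : PreservesFiniteColimits (isKFunctor K C).ι :=
  have := (isKFunctor K C).preservesCokernels_ι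
  Functor.preservesFiniteColimits_of_preservesCokernels _

/-- `Ext`-groups in `Mod(C)` are formed without any smallness assumption, in the next universe. -/
instance : HasExt.{u + 1} (Mod K C) := HasExt.standard _

end Modules

section Ideals

variable (K : Type u) [Field K] (C : Type u) [SmallCategory C] [Preadditive C] [Linear K C]

/-- A two-sided ideal of the `K`-category `C`: a `K`-subspace of every morphism space,
stable under composition with arbitrary morphisms on either side. -/
@[ext]
structure CatIdeal where
  /-- The subspace `I(X, Y)` of `Hom(X, Y)`. -/
  hom (X Y : C) : Submodule K (X ⟶ Y)
  comp_right {X Y Z : C} {f : X ⟶ Y} (hf : f ∈ hom X Y) (g : Y ⟶ Z) : f ≫ g ∈ hom X Z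
  comp_left {W X Y : C} (h : W ⟶ X) {f : X ⟶ Y} (hf : f ∈ hom X Y) : h ≫ f ∈ hom W Y

namespace CatIdeal

variable {K C}

/-- The product of two ideals: `(I J)(X, Z)` consists of the finite sums of composites `g ∘ f`
with `f ∈ J(X, Y)` and `g ∈ I(Y, Z)`, for objects `Y` of `C`. -/
def mul (I J : CatIdeal K C) : CatIdeal K C where
  hom X Z := Submodule.span K
    {h | ∃ (Y : C) (f : X ⟶ Y) (g : Y ⟶ Z), f ∈ J.hom X Y ∧ g ∈ I.hom Y Z ∧ f ≫ g = h}
  comp_right {X Y Z f} hf g := by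
    induction hf using Submodule.span_induction with
    | mem x hx =>
      obtain ⟨W, a, b, ha, hb, rfl⟩ := hx
      exact Submodule.subset_span ⟨W, a, b ≫ g, ha, I.comp_right hb g, by simp⟩
    | zero => simp
    | add x y _ _ hx hy => rw [Preadditive.add_comp]; exact add_mem hx hy
    | smul r x _ hx => rw [Linear.smul_comp]; exact Submodule.smul_mem _ r hx
  comp_left {W X Y} h f hf := by
    induction hf using Submodule.span_induction with
    | mem x hx =>
      obtain ⟨V, a, b, ha, hb, rfl⟩ := hx
      exact Submodule.subset_span ⟨V, h ≫ a, b, J.comp_left h ha, hb, by simp⟩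
    | zero => simp
    | add x y _ _ hx hy => rw [Preadditive.comp_add]; exact add_mem hx hy
    | smul r x _ hx => rw [Linear.comp_smul]; exact Submodule.smul_mem _ r hx

/-- The ideal `I` is idempotent if `I² = I`. -/
def IsIdempotent (I : CatIdeal K C) : Prop := I.mul I = I

/-- The `C`-module `I(X, -)`, a submodule of `C(X, -)`: the action of `g : Y ⟶ Z` sends
`f ∈ I(X, Y)` to `g ∘ f ∈ I(X, Z)`. -/
def homModule (I : CatIdeal K C) (X : C) : Mod K C where
  obj :=
    { obj := fun Y => ModuleCat.of K (I.hom X Y)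
      map := fun {Y Z} g => ModuleCat.ofHom
        ((Linear.rightComp K X g).restrict fun _ hf => I.comp_right hf g)
      map_id := fun Y => by
        ext f
        exact Category.comp_id f.1
      map_comp := fun g h => by
        ext f
        exact (Category.assoc f.1 g h).symm }
  property := by
    refine ⟨⟨fun {Y Z g h} => ?_⟩, ⟨fun {Y Z} g r => ?_⟩⟩
    · ext f
      exact Preadditive.comp_add _ _ _ f.1 g h
    · ext f
      exact Linear.comp_smul _ _ _ f.1 r g

/-! ### The quotient category `C / I` -/

/-- Two parallel morphisms are identified in `C / I` when their difference lies in `I`. -/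
def rel (I : CatIdeal K C) : HomRel C := fun X Y f g => f - g ∈ I.hom X Y

instance (I : CatIdeal K C) : Congruence I.rel where
  equivalence {X Y} :=
    { refl := fun f => by simp [rel]
      symm := fun {f g} h => by simpa [rel] using (I.hom X Y).neg_mem h
      trans := fun {f g h} h₁ h₂ => by simpa [rel] using (I.hom X Y).add_mem h₁ h₂ }
  comp_left f _ _ h := by
    simpa only [rel, Preadditive.comp_sub] using I.comp_left f h
  comp_right g h := by
    simpa only [rel, Preadditive.sub_comp] using I.comp_right h g

/-- The quotient category `C / I`: it has the objects of `C`, and its morphism spaces are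
`C(X, Y) / I(X, Y)`. -/
abbrev QuotCat (I : CatIdeal K C) := CategoryTheory.Quotient I.rel

/-- The canonical projection `π : C ⥤ C / I`. -/
abbrev proj (I : CatIdeal K C) : C ⥤ I.QuotCat := CategoryTheory.Quotient.functor I.rel

instance (I : CatIdeal K C) : Preadditive I.QuotCat :=
  CategoryTheory.Quotient.preadditive I.rel fun X Y f₁ f₂ g₁ g₂ h₁ h₂ => by
    simpa [rel, add_sub_add_comm] using (I.hom X Y).add_mem h₁ h₂

instance (I : CatIdeal K C) : I.proj.Additive where
  map_add := rfl

instance (I : CatIdeal K C) : Linear K I.QuotCat :=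
  CategoryTheory.Quotient.linear K I.rel fun a X Y f₁ f₂ h => by
    simpa [rel, smul_sub] using (I.hom X Y).smul_mem a h

instance (I : CatIdeal K C) : I.proj.Linear K where
  map_smul _ _ := rfl

/-- The restriction functor `π_* : Mod(C / I) ⥤ Mod(C)`, `F ↦ F ∘ π`. -/
def restrict (I : CatIdeal K C) : Mod K I.QuotCat ⥤ Mod K C :=
  (isKFunctor K C).lift
    ((isKFunctor K I.QuotCat).ι ⋙ (Functor.whiskeringLeft C I.QuotCat (ModuleCat.{u} K)).obj I.proj)
    fun F => by
      obtain ⟨_, _⟩ := F.property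
      exact ⟨inferInstanceAs (I.proj ⋙ F.obj).Additive, inferInstanceAs ((I.proj ⋙ F.obj).Linear K)⟩

instance (I : CatIdeal K C) : I.restrict.Additive where
  map_add := rfl

instance (I : CatIdeal K C) : I.restrict.Linear K where
  map_smul _ _ := rfl

instance (I : CatIdeal K C) : PreservesFiniteLimits I.restrict :=
  have : PreservesFiniteLimits (I.restrict ⋙ (isKFunctor K C).ι) :=
    inferInstanceAs (PreservesFiniteLimits ((isKFunctor K I.QuotCat).ι ⋙
      (Functor.whiskeringLeft C I.QuotCat (ModuleCat.{u} K)).obj I.proj))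
  preservesFiniteLimits_of_reflects_of_preserves I.restrict (isKFunctor K C).ι

instance (I : CatIdeal K C) : PreservesFiniteColimits I.restrict :=
  have : PreservesFiniteColimits (I.restrict ⋙ (isKFunctor K C).ι) :=
    inferInstanceAs (PreservesFiniteColimits ((isKFunctor K I.QuotCat).ι ⋙
      (Functor.whiskeringLeft C I.QuotCat (ModuleCat.{u} K)).obj I.proj))
  preservesFiniteColimits_of_reflects_of_preserves I.restrict (isKFunctor K C).ι

/-- The ideal `I` is strongly idempotent if for all `C / I`-modules `F`, `F'` and all `i ≥ 0`
the `K`-linear map `Ext^i(F, F') → Ext^i(π_* F, π_* F')`, from extensions in `Mod(C / I)` to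
extensions in `Mod(C)`, induced by the exact functor `π_*` is an isomorphism. -/
def IsStronglyIdempotent (I : CatIdeal K C) : Prop :=
  ∀ (F F' : Mod K I.QuotCat) (i : ℕ),
    Function.Bijective (I.restrict.mapExtLinearMap K F F' i)

end CatIdeal
end Ideals
end KCat
end

open CategoryTheory.Abelian

noncomputable section

/-! The functor `π_*` is exact and fully faithful, so degree 0 is settled, and higher degrees follow
by dimension shifting along covers `P ⟶ F` that are acyclic on both sides
(`Functor.mapExt_bijective_of_acyclic_cover`). Take `P = ⨁ (C/I)(Xⱼ, -)`, which is projective over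
`C/I`. Over `C`, `shortExact_directSumSequence` gives `0 ⟶ ⨁ I(Xⱼ, -) ⟶ ⨁ C(Xⱼ, -) ⟶ π_* P ⟶ 0`, by
hypothesis a projective resolution, so `Ext^i(π_* P, -)` vanishes for `i ≥ 2`. `Ext¹(π_* P, π_* F')`
is a quotient of `Hom(⨁ I(Xⱼ, -), π_* F')`, which is zero by `IsIdempotent.hom_restrict_eq_zero`:
idempotency enters only here. -/

namespace CategoryTheory

/-! ### Dimension shifting for `Ext` along an exact functor. -/

section Ext

universe w w' v v' u₁ u₂

variable {A : Type u₁} [Category.{v} A] [Abelian A] {B : Type u₂} [Category.{v'} B] [Abelian B]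

/-- If `0 ⟶ S.X₁ ⟶ S.X₂ ⟶ S.X₃ ⟶ 0` is a projective resolution of length one and there are no
nonzero morphisms `S.X₁ ⟶ Y`, then all higher extensions of `S.X₃` by `Y` vanish. -/
lemma ShortComplex.ShortExact.subsingleton_ext_succ [HasExt.{w} A] {S : ShortComplex A}
    (hS : S.ShortExact) [Projective S.X₁] [Projective S.X₂] {Y : A}
    (hY : ∀ f : S.X₁ ⟶ Y, f = 0) (n : ℕ) : Subsingleton (Ext.{w} S.X₃ Y (n + 1)) := by
  refine subsingleton_of_forall_eq 0 fun e => ?_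
  obtain ⟨z, rfl⟩ := Ext.contravariant_sequence_exact₃ hS Y e (Ext.eq_zero_of_projective _)
    (add_comm 1 n)
  have hz : z = 0 := by
    -- Degree 0 uses the absence of morphisms; positive degrees use projectivity of `S.X₁`.
    cases n with
    | zero =>
      obtain ⟨f, rfl⟩ := (Ext.mk₀_bijective _ _).2 z
      rw [hY f, Ext.mk₀_zero]
    | succ n => exact Ext.eq_zero_of_projective z
  rw [hz, Ext.comp_zero]

/-- A fully faithful exact functor `G` induces bijections on extension groups as soon as every
object is a quotient of an object `P` for which the higher extensions of `P`, and those of `G.obj P`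
by objects in the image of `G`, vanish. -/
lemma Functor.mapExt_bijective_of_acyclic_cover [HasExt.{w} A] [HasExt.{w'} B] (G : A ⥤ B)
    [G.Additive] [PreservesFiniteLimits G] [PreservesFiniteColimits G] [G.Full] [G.Faithful]
    (hG : ∀ X : A, ∃ (P : A) (p : P ⟶ X), Epi p ∧ ∀ (Y : A) (n : ℕ),
      Subsingleton (Ext.{w} P Y (n + 1)) ∧ Subsingleton (Ext.{w'} (G.obj P) (G.obj Y) (n + 1)))
    (X Y : A) (n : ℕ) : Function.Bijective (G.mapExtAddHom X Y n) := by
  -- `X` varies because the shift replaces it by the kernel of its cover.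
  induction n generalizing X with
  | zero =>
    rw [G.mapExtAddHom_coe, Ext.mapExactFunctor₀]
    exact Ext.homEquiv₀.symm.bijective.comp
      (.comp ⟨G.map_injective, G.map_surjective⟩ Ext.homEquiv₀.bijective)
  | succ n hn =>
    obtain ⟨P, p, _, hP⟩ := hG X
    let S := ShortComplex.mk _ _ (kernel.condition p)
    have hS : S.ShortExact := { exact := ShortComplex.exact_kernel p }
    have : Subsingleton (Ext.{w} S.X₂ Y (n + 1)) := (hP Y n).1
    have : Subsingleton (Ext.{w'} (S.map G).X₂ (G.obj Y) (n + 1)) := (hP Y n).2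
    exact AddMonoidHom.bijective_of_surjective_of_bijective_of_right_exact _ _ _ _
      (G.mapExtAddHom S.X₂ Y n) (G.mapExtAddHom S.X₁ Y n) (G.mapExtAddHom S.X₃ Y (n + 1))
      (AddMonoidHom.ext fun x => by
        simpa [Ext.mapExactFunctor_mk₀] using!
          (Ext.mapExactFunctor_comp G (Ext.mk₀ S.f) x (zero_add n)).symm)
      (AddMonoidHom.ext fun x => by
        simpa [Ext.mapExactFunctor_extClass] using!
          (Ext.mapExactFunctor_comp G hS.extClass x (add_comm 1 n)).symm)
      ((ShortComplex.ab_exact_iff_function_exact _).1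
        (Ext.contravariant_sequence_exact₁' hS Y n (n + 1) (add_comm 1 n)))
      ((ShortComplex.ab_exact_iff_function_exact _).1
        (Ext.contravariant_sequence_exact₁' (hS.map G) (G.obj Y) n (n + 1) (add_comm 1 n)))
      (hn _).surjective (hn _)
      -- Both connecting maps are onto, since the next term is an `Ext` in degree `n + 1` out of the
      -- acyclic cover.
      (fun x₃ ↦ Ext.contravariant_sequence_exact₃ hS _ x₃ (by subsingleton) (add_comm 1 n))
      (fun y₃ ↦ Ext.contravariant_sequence_exact₃ (hS.map G) _ y₃ (by subsingleton) (add_comm 1 n))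

end Ext

end CategoryTheory

namespace KCat

/-! ### Pointwise exactness, representables and direct sums in `Mod(C)`. -/

section Modules

variable {K : Type u} [Field K] {C : Type u} [SmallCategory C] [Preadditive C] [Linear K C]

namespace Mod

lemma hom_ext {M N : Mod K C} {f g : M ⟶ N}
    (h : ∀ (Y : C) (x : M.obj.obj Y), f.hom.app Y x = g.hom.app Y x) : f = g := by
  ext Y x
  exact h Y x

lemma map_add_apply (M : Mod K C) {X Y : C} (f g : X ⟶ Y) (x : M.obj.obj X) :
    M.obj.map (f + g) x = M.obj.map f x + M.obj.map g x := by
  obtain ⟨_, _⟩ := M.property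
  simp

lemma map_smul_apply (M : Mod K C) {X Y : C} (r : K) (f : X ⟶ Y) (x : M.obj.obj X) :
    M.obj.map (r • f) x = r • M.obj.map f x := by
  obtain ⟨_, _⟩ := M.property
  simp

lemma map_zero_apply (M : Mod K C) {X Y : C} (x : M.obj.obj X) :
    M.obj.map (0 : X ⟶ Y) x = 0 := by
  simpa using M.map_smul_apply (0 : K) (0 : X ⟶ Y) x

lemma epi_of_surjective {M N : Mod K C} (p : M ⟶ N)
    (hp : ∀ Y, Function.Surjective (p.hom.app Y)) : Epi p := by
  have : ∀ Y, Epi (p.hom.app Y) := fun Y => (ModuleCat.epi_iff_surjective _).2 (hp Y)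
  have : Epi ((isKFunctor K C).ι.map p) := NatTrans.epi_of_epi_app p.hom
  exact (isKFunctor K C).ι.epi_of_epi_map this

lemma mono_of_injective {M N : Mod K C} (i : M ⟶ N)
    (hi : ∀ Y, Function.Injective (i.hom.app Y)) : Mono i := by
  have : ∀ Y, Mono (i.hom.app Y) := fun Y => (ModuleCat.mono_iff_injective _).2 (hi Y)
  have : Mono ((isKFunctor K C).ι.map i) := NatTrans.mono_of_mono_app i.hom
  exact (isKFunctor K C).ι.mono_of_mono_map this

lemma surjective_of_epi {M N : Mod K C} (p : M ⟶ N) [Epi p] (Y : C) :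
    Function.Surjective (p.hom.app Y) := by
  have : Epi p.hom := inferInstanceAs (Epi ((isKFunctor K C).ι.map p))
  exact (ModuleCat.epi_iff_surjective _).1 inferInstance

/-- A sequence of `C`-modules which is short exact at every object is short exact. -/
lemma shortExact_of_pointwise (S : ShortComplex (Mod K C))
    (hf : ∀ Y, Function.Injective (S.f.hom.app Y))
    (hfg : ∀ Y, Function.Exact (S.f.hom.app Y) (S.g.hom.app Y))
    (hg : ∀ Y, Function.Surjective (S.g.hom.app Y)) : S.ShortExact where
  mono_f := mono_of_injective _ hf
  epi_g := epi_of_surjective _ hg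
  exact := by
    -- Evaluation is exact, so it commutes with homology, and a functor is zero once all its values
    -- are.
    rw [← S.exact_map_iff_of_faithful (isKFunctor K C).ι, ShortComplex.exact_iff_isZero_homology]
    refine (Functor.isZero_iff _).2 fun Y => ?_
    have h : ((S.map (isKFunctor K C).ι).map
        ((evaluation C (ModuleCat.{u} K)).obj Y)).Exact :=
      (ShortComplex.ShortExact.moduleCat_exact_iff_function_exact _).2 (hfg Y)
    rw [ShortComplex.exact_iff_isZero_homology] at h
    exact h.of_iso ((S.map (isKFunctor K C).ι).mapHomologyIso
      ((evaluation C (ModuleCat.{u} K)).obj Y)).symm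

variable (K) in
/-- The representable `C`-module `C(X, -)`. -/
def representable (X : C) : Mod K C where
  obj :=
    { obj := fun Y => ModuleCat.of K (X ⟶ Y)
      map := fun g => ModuleCat.ofHom (Linear.rightComp K X g)
      map_id := fun Y => by
        ext f
        exact Category.comp_id f
      map_comp := fun g h => by
        ext f
        exact (Category.assoc f g h).symm }
  property := by
    refine ⟨⟨fun {Y Z g h} => ?_⟩, ⟨fun {Y Z} g r => ?_⟩⟩
    · ext f
      exact Preadditive.comp_add _ _ _ f g h
    · ext f
      exact Linear.comp_smul _ _ _ f r g

/-- The morphism `C(X, -) ⟶ M` corresponding to an element of `M(X)`. -/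
def representableDesc {X : C} (M : Mod K C) (x : M.obj.obj X) : representable K X ⟶ M :=
  ObjectProperty.homMk
    { app := fun Y => ModuleCat.ofHom
        { toFun := fun f : X ⟶ Y => M.obj.map f x
          map_add' := fun f g => M.map_add_apply f g x
          map_smul' := fun r f => M.map_smul_apply r f x }
      naturality := fun Y Z g => by
        ext f
        exact congr($(M.obj.map_comp (f : X ⟶ Y) g) x) }

lemma representableDesc_app {X Y : C} (M : Mod K C) (x : M.obj.obj X) (f : X ⟶ Y) :
    (representableDesc M x).hom.app Y f = M.obj.map f x := rfl

lemma hom_app_representable {X Y : C} {M : Mod K C} (φ : representable K X ⟶ M) (f : X ⟶ Y) :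
    φ.hom.app Y f = M.obj.map f (φ.hom.app X (𝟙 X)) := by
  have h := congr($(φ.hom.naturality f) (𝟙 X))
  have h' : (representable K X).obj.map f (𝟙 X) = f := Category.id_comp f
  change φ.hom.app Y ((representable K X).obj.map f (𝟙 X)) = _ at h
  rw [h'] at h
  exact h

/-- By Yoneda, a lift amounts to a preimage of the image of `𝟙 X`. -/
instance (X : C) : Projective (representable K X) where
  factors {E M} φ p _ := by
    obtain ⟨x, hx⟩ := surjective_of_epi p X (φ.hom.app X (𝟙 X))
    refine ⟨representableDesc E x, hom_ext fun Y f => ?_⟩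
    rw [hom_app_representable φ f, ← hx]
    exact congr($(p.hom.naturality (f : X ⟶ Y)) x)

variable {J : Type u}

open DirectSum

/-- The direct sum of a family of `C`-modules. -/
def directSum (M : J → Mod K C) : Mod K C where
  obj :=
    { obj := fun Y => ModuleCat.of K (⨁ j, (M j).obj.obj Y)
      map := fun g => ModuleCat.ofHom (DirectSum.lmap fun j => ((M j).obj.map g).hom)
      map_id := fun Y => by
        ext x : 2
        refine DFinsupp.ext fun j => ?_
        exact congr($((M j).obj.map_id Y) ((x : ⨁ j, (M j).obj.obj Y) j))
      map_comp := fun {X Y Z} g h => by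
        ext x : 2
        refine DFinsupp.ext fun j => ?_
        exact congr($((M j).obj.map_comp g h) ((x : ⨁ j, (M j).obj.obj X) j)) }
  property := by
    refine ⟨⟨fun {Y Z g h} => ?_⟩, ⟨fun {Y Z} g r => ?_⟩⟩
    · ext x : 2
      refine DFinsupp.ext fun j => ?_
      exact (M j).map_add_apply g h ((x : ⨁ j, (M j).obj.obj Y) j)
    · ext x : 2
      refine DFinsupp.ext fun j => ?_
      exact (M j).map_smul_apply r g ((x : ⨁ j, (M j).obj.obj Y) j)

open Classical in
/-- The inclusion of a summand in a direct sum. -/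
def directSumInclusion (M : J → Mod K C) (j : J) : M j ⟶ directSum M :=
  ObjectProperty.homMk
    { app := fun Y => ModuleCat.ofHom (DirectSum.lof K J (fun j => (M j).obj.obj Y) j)
      naturality := fun Y Z g => by
        ext x : 2
        exact (DirectSum.lmap_lof (fun j => ((M j).obj.map g).hom) j x).symm }

lemma directSum_hom_ext {M : J → Mod K C} {N : Mod K C} {f g : directSum M ⟶ N}
    (h : ∀ j, directSumInclusion M j ≫ f = directSumInclusion M j ≫ g) : f = g := by
  classical
  ext Y : 4
  refine DirectSum.linearMap_ext K fun j => LinearMap.ext fun x => ?_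
  exact congr(($(h j)).hom.app Y x)

open Classical in
/-- The morphism out of a direct sum given by morphisms out of its summands. -/
def directSumDesc {M : J → Mod K C} {N : Mod K C} (f : ∀ j, M j ⟶ N) : directSum M ⟶ N :=
  ObjectProperty.homMk
    { app := fun Y => ModuleCat.ofHom (DirectSum.toModule K J _ fun j => ((f j).hom.app Y).hom)
      naturality := fun Y Z g => by
        ext : 1
        refine DirectSum.linearMap_ext K fun j => LinearMap.ext fun x => ?_
        have h₁ := DirectSum.toModule_lof K (φ := fun j => ((f j).hom.app Y).hom) j x
        have h₂ := DirectSum.toModule_lof K (φ := fun j => ((f j).hom.app Z).hom) j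
          ((M j).obj.map g x)
        have h₃ := DirectSum.lmap_lof (R := K) (fun j => ((M j).obj.map g).hom) j x
        exact (congrArg _ h₃).trans <| h₂.trans <|
          (congr($((f j).hom.naturality g) x)).trans (congrArg (N.obj.map g) h₁).symm }

lemma directSumInclusion_desc {M : J → Mod K C} {N : Mod K C} (f : ∀ j, M j ⟶ N) (j : J) :
    directSumInclusion M j ≫ directSumDesc f = f j := by
  classical
  exact hom_ext fun Y x => DirectSum.toModule_lof K (φ := fun j => ((f j).hom.app Y).hom) j x

instance (M : J → Mod K C) [∀ j, Projective (M j)] : Projective (directSum M) where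
  factors {E N} φ p _ := by
    refine ⟨directSumDesc fun j => Projective.factorThru (directSumInclusion M j ≫ φ) p, ?_⟩
    refine directSum_hom_ext fun j => ?_
    rw [← Category.assoc, directSumInclusion_desc, Projective.factorThru_comp]

/-- Every `C`-module is a quotient of a direct sum of representables. -/
def representableCover (M : Mod K C) :
    directSum (fun j : Σ X : C, M.obj.obj X => representable K j.1) ⟶ M :=
  directSumDesc fun j => representableDesc M j.2

instance (M : Mod K C) : Epi M.representableCover := by
  refine epi_of_surjective _ fun Y x => ?_
  let j : Σ X : C, M.obj.obj X := ⟨Y, x⟩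
  let ι := directSumInclusion (fun j : Σ X : C, M.obj.obj X => representable K j.1) j
  -- The identity in the summand indexed by `(Y, x)` maps to `x`.
  refine ⟨ι.hom.app Y (𝟙 Y), ?_⟩
  have h : ι ≫ M.representableCover = _ := directSumInclusion_desc _ j
  have h' := congr(($h).hom.app Y (𝟙 Y))
  refine h'.trans ?_
  rw [representableDesc_app]
  exact congr($(M.obj.map_id Y) x)

end Mod

end Modules

/-! ### Restriction along `π` and the resolution attached to an ideal. -/

namespace CatIdeal

variable {K : Type u} [Field K] {C : Type u} [SmallCategory C] [Preadditive C] [Linear K C]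
  (I : CatIdeal K C)

instance : I.restrict.Faithful where
  map_injective h := Mod.hom_ext fun Y x => congr(($h).hom.app Y.as x)

instance : I.restrict.Full where
  map_surjective {F G} φ := by
    refine ⟨ObjectProperty.homMk
      { app := fun Y => φ.hom.app Y.as
        naturality := fun Y Z g => ?_ }, rfl⟩
    -- As `π` is full, naturality over `C` already gives naturality over `C/I`.
    obtain ⟨g, rfl⟩ := I.proj.map_surjective (X := Y.as) (Y := Z.as) g
    exact φ.hom.naturality g

lemma proj_map_eq_zero_iff {X Y : C} (f : X ⟶ Y) : I.proj.map f = 0 ↔ f ∈ I.hom X Y := by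
  rw [← I.proj.map_zero X Y, CategoryTheory.Quotient.functor_map_eq_iff]
  simp [rel]

variable {I} in
/-- An idempotent ideal `I` has no nonzero morphisms from `I(X, -)` to modules killed by `I`. -/
lemma IsIdempotent.hom_restrict_eq_zero (hI : I.IsIdempotent) {X : C} {F : Mod K I.QuotCat}
    (φ : I.homModule X ⟶ I.restrict.obj F) : φ = 0 := by
  -- For `a, b ∈ I`, naturality gives `φ(b ∘ a) = b · φ(a)`, and `b` acts as zero on `π_* F`. The
  -- proof `hf` is quantified so that the induction may vary `f`.
  have key : ∀ {Y : C} (f : X ⟶ Y), f ∈ (I.mul I).hom X Y →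
      ∀ hf : f ∈ I.hom X Y, φ.hom.app Y (⟨f, hf⟩ : I.hom X Y) = 0 := by
    intro Y f hf
    induction hf using Submodule.span_induction with
    | mem x hx =>
      obtain ⟨Z, a, b, ha, hb, rfl⟩ := hx
      intro _
      have h := congr($(φ.hom.naturality b) (⟨a, ha⟩ : I.hom X Z))
      refine h.trans ?_
      change F.obj.map (I.proj.map b) (φ.hom.app Z (⟨a, ha⟩ : I.hom X Z)) = 0
      rw [(I.proj_map_eq_zero_iff b).2 hb]
      exact F.map_zero_apply _
    | zero => exact fun _ => map_zero (φ.hom.app Y).hom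
    | add x y hx hy ihx ihy =>
      have hx' : x ∈ I.hom X Y := by rw [← hI]; exact hx
      have hy' : y ∈ I.hom X Y := by rw [← hI]; exact hy
      intro _
      refine (map_add (φ.hom.app Y).hom (⟨x, hx'⟩ : I.hom X Y) ⟨y, hy'⟩).trans ?_
      exact (congrArg₂ (· + ·) (ihx hx') (ihy hy')).trans (add_zero _)
    | smul r x hx ihx =>
      have hx' : x ∈ I.hom X Y := by rw [← hI]; exact hx
      intro _
      refine (map_smul (φ.hom.app Y).hom r (⟨x, hx'⟩ : I.hom X Y)).trans ?_
      exact (congrArg (r • ·) (ihx hx')).trans (smul_zero _)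
  refine Mod.hom_ext fun Y f => ?_
  have hf : (f : I.hom X Y).1 ∈ (I.mul I).hom X Y := by rw [hI]; exact f.2
  exact key f.1 hf f.2

/-- The sequence `⨁ I(Xⱼ, -) ⟶ ⨁ C(Xⱼ, -) ⟶ π_* (⨁ (C / I)(π Xⱼ, -))` of `C`-modules. -/
def directSumSequence {J : Type u} (X : J → I.QuotCat) : ShortComplex (Mod K C) where
  X₁ := Mod.directSum fun j => I.homModule (X j).as
  X₂ := Mod.directSum fun j => Mod.representable K (X j).as
  X₃ := I.restrict.obj (Mod.directSum fun j => Mod.representable K (X j))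
  f := ObjectProperty.homMk
    { app := fun Y => ModuleCat.ofHom (DirectSum.lmap fun j => (I.hom (X j).as Y).subtype)
      naturality := fun _ _ _ => by
        ext x : 2
        exact DFinsupp.ext fun j => rfl }
  g := ObjectProperty.homMk
    { app := fun Y => ModuleCat.ofHom (DirectSum.lmap fun j =>
        I.proj.mapLinearMap K (X := (X j).as) (Y := Y))
      naturality := fun _ _ _ => by
        ext x : 2
        exact DFinsupp.ext fun j => I.proj.map_comp _ _ }
  zero := Mod.hom_ext fun Y x => DFinsupp.ext fun j =>
    (I.proj_map_eq_zero_iff _).2 (DFunLike.coe (F := DirectSum J fun j => I.hom (X j).as Y) x j).2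

lemma shortExact_directSumSequence {J : Type u} (X : J → I.QuotCat) :
    (I.directSumSequence X).ShortExact := by
  refine Mod.shortExact_of_pointwise _ (fun Y => ?_) (fun Y => ?_) (fun Y => ?_)
  · exact (DirectSum.lmap_injective _).2 fun j => Subtype.val_injective
  · change Function.Exact (DirectSum.lmap fun j => (I.hom (X j).as Y).subtype)
      (DirectSum.lmap fun j => I.proj.mapLinearMap K (X := (X j).as) (Y := Y))
    -- Kernel and range are computed summandwise, leaving `ker π = I` on each morphism space.
    rw [LinearMap.exact_iff, DirectSum.ker_lmap, DirectSum.range_lmap]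
    congr! 3 with j
    ext f
    simpa using I.proj_map_eq_zero_iff f
  · exact (DirectSum.lmap_surjective _).2 fun j => I.proj.map_surjective

end CatIdeal

end KCat

theorem proposition4p5 {K : Type u} [Field K] {C : Type u} [SmallCategory C] [Preadditive C]
    [Linear K C] (I : KCat.CatIdeal K C) (hI : I.IsIdempotent)
    (hproj : ∀ X : C, Projective (I.homModule X)) :
    I.IsStronglyIdempotent := by
  refine I.restrict.mapExt_bijective_of_acyclic_cover fun F =>
    ⟨_, F.representableCover, inferInstance, fun F' n =>
      ⟨Ext.subsingleton_of_projective _ _ _, ?_⟩⟩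
  let S := I.directSumSequence fun j : Σ X : I.QuotCat, F.obj.obj X => j.1
  have : Projective S.X₁ := inferInstanceAs (Projective (KCat.Mod.directSum _))
  have : Projective S.X₂ := inferInstanceAs (Projective (KCat.Mod.directSum _))
  refine (I.shortExact_directSumSequence _).subsingleton_ext_succ (S := S) (fun f => ?_) n
  -- On each summand both sides are morphisms from some `I(X, -)` to `π_* F'`, hence zero.
  refine KCat.Mod.directSum_hom_ext fun j => ?_
  exact (hI.hom_restrict_eq_zero _).trans (hI.hom_restrict_eq_zero _).symm

end
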